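/- Let $\mathbb{T}=\mathbb{R}/2\pi\mathbb{Z}$ and identify functions on $\mathbb{T}$ with $2\pi$-periodic functions on $\mathbb{R}$. For $0<\alpha<1$ and an integer $k\ge 1$, let $C^{k,\alpha}(\mathbb{T})$ be the space of $k$ times continuously differentiable functions $f:\mathbb{T}\to\mathbb{R}$ for which $$\|f\|_{C^{k,\alpha}}=\sum_{\ell=0}^{k}\sup_{x}|f^{(\ell)}(x)|+\sup_{x_1\neq x_2}\frac{|f^{(k)}(x_1)-f^{(k)}(x_2)|}{|x_1-x_2|^{\alpha}}$$ is finite. Let $$\mathcal{H}[f](x)=\frac1{2\pi}\,\mathrm{p.v.}\!\int_{-\pi}^{\pi}\frac{f(y)}{\tan\left(\frac{x-y}{2}\right)}\,dy$$ be the periodic Hilbert transform and $[\mathcal{H},a](g)=\mathcal{H}[ag]-a\,\mathcal{H}[g]$ its commutator with multiplication by $a$. **Lemma.** For every $\alpha\in(0,1)$ there is a constant $C>0$, depending only on $\alpha$, such that for all $a\in C^{2,\alpha}(\mathbb{T})$ and $b\in C^{1,\alpha}(\mathbb{T})$ the principal values defining $\mathcal{H}[ab']$ and $\mathcal{H}[b']$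 exist at every point, $[\mathcal{H},a](b')\in C^{1,\alpha}(\mathbb{T})$, and $$\|[\mathcal{H},a](b')\|_{C^{1,\alpha}}\le C\,\|a\|_{C^{2,\alpha}}\,\|b\|_{C^{1,\alpha}}.$$ -/

import Mathlib

open Real Set Filter Topology MeasureTheory
open scoped ENNReal NNReal

noncomputable section

namespace PeriodicHolder

/-!
The circle is `𝕋 = ℝ / 2πℤ`; a real function on `𝕋` is a `2π`-periodic function `ℝ → ℝ`, and its
derivatives are those of the periodic function. All norms take values in `[0, ∞]`.
-/

/-- The supremum norm `‖f‖_{C⁰} = sup_x |f x|`. -/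
def supNorm (f : ℝ → ℝ) : ℝ≥0∞ := ⨆ x : ℝ, ‖f x‖ₑ

/-- The Hölder seminorm `sup_{x₁ ≠ x₂} |f x₁ - f x₂| / |x₁ - x₂| ^ α`. For a periodic `f` the
supremum over pairs of reals is the supremum over pairs of points of the circle with its arc-length
distance, since that distance is the least `|x₁ - x₂|` over all representatives. -/
def holderSeminorm (α : ℝ) (f : ℝ → ℝ) : ℝ≥0∞ :=
  ⨆ (x₁ : ℝ) (x₂ : ℝ) (_ : x₁ ≠ x₂), ENNReal.ofReal (|f x₁ - f x₂| / |x₁ - x₂| ^ α)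

/-- The norm `‖f‖_{C^{k,α}} = ∑_{ℓ < k} ‖f^(ℓ)‖_{C⁰} + ‖f^(k)‖_{C⁰} + [f^(k)]_α`, that is
`‖f‖_{C^{k-1}} + ‖f^(k)‖_{C^α}`. -/
def holderNorm (k : ℕ) (α : ℝ) (f : ℝ → ℝ) : ℝ≥0∞ :=
  (∑ l ∈ Finset.range k, supNorm (iteratedDeriv l f)) +
    (supNorm (iteratedDeriv k f) + holderSeminorm α (iteratedDeriv k f))

/-- `f ∈ C^{k,α}(𝕋)`: `f` is `2π`-periodic, `k` times continuously differentiable, and its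
`C^{k,α}` norm is finite. -/
structure MemCkα (k : ℕ) (α : ℝ) (f : ℝ → ℝ) : Prop where
  periodic : Function.Periodic f (2 * π)
  contDiff : ContDiff ℝ k f
  norm_lt_top : holderNorm k α f < ∞

/-- The truncated singular integral
`(2π)⁻¹ ∫_{ε < |x - y| ≤ π} f(y) / tan ((x - y) / 2) dy`. The integration is over one period, taken
centred at `x`; for a periodic `f` the integrand is `2π`-periodic in `y`, so this is the integral
over `[-π, π]` with the points at circle-distance at most `ε` from `x` removed. -/
def truncHilbert (f : ℝ → ℝ) (x ε : ℝ) : ℝ :=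
  1 / (2 * π) * ∫ y in {y : ℝ | ε < |x - y| ∧ |x - y| ≤ π}, f y / tan ((x - y) / 2)

/-- The principal value defining `ℋ f (x)` exists and equals `L`. -/
def HasHilbertAt (f : ℝ → ℝ) (x L : ℝ) : Prop :=
  Tendsto (truncHilbert f x) (𝓝[>] 0) (𝓝 L)

/-- The periodic Hilbert transform
`ℋ f (x) = (2π)⁻¹ p.v. ∫_{-π}^{π} f(y) / tan ((x - y) / 2) dy`. It is only meaningful at `x` if
the principal value exists there, i.e. if `∃ L, HasHilbertAt f x L`. -/
def hilbert (f : ℝ → ℝ) (x : ℝ) : ℝ := limUnder (𝓝[>] 0) (truncHilbert f x)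

/-- The commutator `⟦T, f⟧[g] = T (f g) - f T(g)`. -/
def commutator (T : (ℝ → ℝ) → (ℝ → ℝ)) (f g : ℝ → ℝ) : ℝ → ℝ :=
  T (f * g) - f * T g

end PeriodicHolder

end

/-! The commutator has no singularity left. Since `cot` is odd, each principal value may be taken
after subtracting the value of the function at `x`. Hölder continuity of `b'` then makes both
integrals absolutely convergent, and their combination is `[ℋ, a](b')(x) = (2π)⁻¹ ∫ (a y - a x) cot
((x - y) / 2) b'(y) dy`, with a kernel bounded by a multiple of `‖a'‖_{C⁰}`. From here on only the
supremum of `|b'|` matters; every derivative falls on the kernel.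

Write `t = x - y`. Minus the `x`-derivative of the kernel is `(a y - a x + a' x sin t) / (1 - cos
t)`. Its numerator is a Taylor remainder of order `t ^ 2`, so the quotient is bounded
(`abs_commKernelDeriv_le`). One more derivative costs only `|t| ^ (α - 1)`, because the Hölder bound
on `a''` leaves a remainder of order `|t| ^ (2 + α)` (`exists_hasDerivAt_commKernelDeriv`).

For the Hölder bound, `x` and `z` are compared at fixed `y`. If `y` is far from `x` relative to `|z
- x|`, the mean value inequality applies; if it is near, boundedness suffices. Both cases fit under
the majorant `|z - x| ^ α * |x - y| ^ (-α)`, integrable in `y` because `α < 1`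
(`abs_commKernelDeriv_sub_le`). The same majorant times `|z - x|` controls the first-order expansion
of the kernel (`abs_commKernel_sub_add_le`), which gives differentiability of the integral directly.
-/

namespace PeriodicHolder

/-! ### Elementary trigonometric estimates -/

theorem abs_sin_sub_self_le (t : ℝ) : |sin t - t| ≤ |t| ^ 3 / 6 := by
  rw [abs_sub_comm]; exact abs_sub_sin_le t

theorem abs_one_sub_cos_sub_le (t : ℝ) : |1 - cos t - t ^ 2 / 2| ≤ t ^ 4 / 24 := by
  have h1 : cos t = 1 - 2 * sin (t / 2) ^ 2 := by
    have := cos_sq (t / 2)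
    have h2 := sin_sq_add_cos_sq (t / 2)
    rw [show 2 * (t / 2) = t by ring] at this
    linarith
  have h2 := abs_sin_sub_self_le (t / 2)
  have h3 : |sin (t / 2) + t / 2| ≤ |t| := by
    refine (abs_add_le _ _).trans ?_
    have := abs_sin_le_abs (x := t / 2)
    rw [abs_div, abs_two] at *
    linarith
  have h4 : 1 - cos t - t ^ 2 / 2 = 2 * (sin (t / 2) - t / 2) * (sin (t / 2) + t / 2) := by
    rw [h1]; ring
  rw [h4, abs_mul, abs_mul, abs_two]
  calc 2 * |sin (t / 2) - t / 2| * |sin (t / 2) + t / 2|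
      ≤ 2 * (|t / 2| ^ 3 / 6) * |t| := by gcongr
    _ = |t| ^ 4 / 24 := by rw [abs_div, abs_two]; ring
    _ = t ^ 4 / 24 := by rw [Even.pow_abs ⟨2, rfl⟩]

/-- The range `|t| ≤ 4` stays inside `(-2π, 2π)`, so `0` is the only zero of `1 - cos`. It also
contains every `z - y` with `|x - y| ≤ π` and `|z - x| ≤ 1 / 2`. Jordan's inequality on either side
of `π / 2` gives `sin s ≥ s / 5` on `[0, 2]`, and the half-angle formula turns this into `1 / 50`.
-/
theorem sq_div_le_one_sub_cos {t : ℝ} (ht : |t| ≤ 4) : t ^ 2 / 50 ≤ 1 - cos t := by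
  have key : ∀ s : ℝ, 0 ≤ s → s ≤ 2 → s / 5 ≤ sin s := by
    intro s h0 h2
    have hpi := pi_gt_d2
    have hpi' := pi_lt_d2
    have hq : 1 / 2 ≤ 2 / π := by
      rw [div_le_div_iff₀ (by norm_num) pi_pos]; linarith
    rcases le_total s (π / 2) with h | h
    · have := mul_le_sin h0 h
      nlinarith
    · have := mul_le_sin (x := π - s) (by linarith) (by linarith)
      rw [sin_pi_sub] at this
      nlinarith
  have h1 : 1 - cos t = 2 * sin (|t| / 2) ^ 2 := by
    have := cos_sq (|t| / 2)
    have h2 := sin_sq_add_cos_sq (|t| / 2)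
    rw [show 2 * (|t| / 2) = |t| by ring, cos_abs] at this
    linarith
  have h2 := key (|t| / 2) (by positivity) (by linarith)
  rw [h1]
  have h3 : (|t| / 2 / 5) ^ 2 ≤ sin (|t| / 2) ^ 2 := by gcongr
  have h4 := sq_abs t
  nlinarith

/-- Turns Lipschitz bounds into Hölder bounds at bounded distance. -/
theorem abs_le_four_mul_rpow {α t : ℝ} (hα : α ∈ Ioo (0 : ℝ) 1) (ht : |t| ≤ 4) :
    |t| ≤ 4 * |t| ^ α := by
  rcases eq_or_ne t 0 with rfl | h0
  · simp [hα.1.ne']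
  have hpos : 0 < |t| := abs_pos.2 h0
  calc |t| = |t| ^ (1 - α) * |t| ^ α := by
        rw [← rpow_add hpos]; simp
    _ ≤ 4 ^ (1 - α) * |t| ^ α := by
        have : 0 ≤ 1 - α := by linarith [hα.2]
        gcongr
    _ ≤ 4 ^ (1 : ℝ) * |t| ^ α := by
        gcongr
        · norm_num
        · linarith [hα.1]
    _ = 4 * |t| ^ α := by rw [rpow_one]

/-- Near the diagonal, with `r = |z - x|` and `t = |x - y|`, this inserts the integrable majorant
into a bound that has no decay. -/
theorem one_le_two_mul_div_rpow {α r t : ℝ} (hα : α ∈ Ioo (0 : ℝ) 1) (ht : 0 < t)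
    (hnear : t ≤ 2 * r) : 1 ≤ 2 * (r ^ α * t ^ (-α)) := by
  have hr : 0 < r := by linarith
  rw [rpow_neg ht.le, ← div_eq_mul_inv, ← mul_div_assoc, le_div_iff₀ (rpow_pos_of_pos ht _), one_mul]
  calc t ^ α ≤ (2 * r) ^ α := by have := hα.1; gcongr
    _ = 2 ^ α * r ^ α := mul_rpow (by norm_num) hr.le
    _ ≤ 2 ^ (1 : ℝ) * r ^ α := by
      gcongr
      · norm_num
      · exact hα.2.le
    _ = 2 * r ^ α := by rw [rpow_one]

theorem one_le_four_mul_rpow_neg {α t : ℝ} (hα : α ∈ Ioo (0 : ℝ) 1) (ht : 0 < t)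
    (h4 : t ≤ 4) : 1 ≤ 4 * t ^ (-α) := by
  rw [rpow_neg ht.le, ← div_eq_mul_inv, le_div_iff₀ (rpow_pos_of_pos ht _), one_mul]
  calc t ^ α ≤ 4 ^ α := by have := hα.1; gcongr
    _ ≤ 4 ^ (1 : ℝ) := by
      gcongr
      · norm_num
      · exact hα.2.le
    _ = 4 := by rw [rpow_one]

/-! ### The periodic Cauchy kernel -/

/-- The kernel `cot (t / 2)`, written as `sin t / (1 - cos t)`. -/
noncomputable def cotHalf (t : ℝ) : ℝ := sin t / (1 - cos t)

/-- No point is excluded: where `sin (t / 2) = 0` both sides are `0` by division by zero, and where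
`cos (t / 2) = 0` the convention for `tan` yields the true value `0` of the cotangent. -/
theorem div_tan_half (c t : ℝ) : c / tan (t / 2) = c * cotHalf t := by
  have hs : sin t = 2 * sin (t / 2) * cos (t / 2) := by
    rw [← sin_two_mul]; ring_nf
  have hc : 1 - cos t = 2 * sin (t / 2) * sin (t / 2) := by
    have := cos_two_mul (t / 2)
    rw [show 2 * (t / 2) = t by ring] at this
    have h2 := sin_sq_add_cos_sq (t / 2)
    rw [this]; linarith
  rw [cotHalf, tan_eq_sin_div_cos, div_div_eq_mul_div, hs, hc, mul_div_assoc]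
  rcases eq_or_ne (sin (t / 2)) 0 with h | h
  · simp [h]
  · field_simp

theorem cotHalf_neg (t : ℝ) : cotHalf (-t) = -cotHalf t := by
  simp [cotHalf, neg_div]

theorem cotHalf_periodic : Function.Periodic cotHalf (2 * π) := fun t => by
  simp [cotHalf]

@[fun_prop]
theorem measurable_cotHalf : Measurable cotHalf := by
  unfold cotHalf; fun_prop

theorem abs_cotHalf_le {t : ℝ} (ht : |t| ≤ 4) : |cotHalf t| ≤ 50 / |t| := by
  rcases eq_or_ne t 0 with rfl | h0
  · simp [cotHalf]
  have hpos : 0 < |t| := abs_pos.2 h0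
  have hw := sq_div_le_one_sub_cos ht
  rw [← sq_abs] at hw
  have hw0 : 0 < 1 - cos t := lt_of_lt_of_le (by positivity) hw
  rw [cotHalf, abs_div, abs_of_pos hw0, div_le_div_iff₀ hw0 hpos]
  have := abs_sin_le_abs (x := t)
  nlinarith

theorem one_sub_cos_pos {t : ℝ} (h0 : t ≠ 0) (ht : |t| ≤ 4) : 0 < 1 - cos t :=
  lt_of_lt_of_le (by positivity) (sq_div_le_one_sub_cos ht)

theorem hasDerivAt_cotHalf {t : ℝ} (h0 : t ≠ 0) (ht : |t| ≤ 4) :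
    HasDerivAt cotHalf (-1 / (1 - cos t)) t := by
  have hw := one_sub_cos_pos h0 ht
  have hd : HasDerivAt cotHalf _ t :=
    (hasDerivAt_sin t).fun_div ((hasDerivAt_cos t).const_sub 1) hw.ne'
  refine hd.congr_deriv ?_
  rw [div_eq_div_iff (by positivity) hw.ne']
  linear_combination (cos t - 1) * sin_sq_add_cos_sq t

/-! ### Taylor estimates -/

/-- `a` is twice differentiable with derivatives `a₁` and `a₂`, both bounded by `A`, and `a₂` is
`α`-Hölder continuous with constant `A`. -/
structure HolderC2Bound (α A : ℝ) (a a₁ a₂ : ℝ → ℝ) : Prop where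
  deriv₁ : ∀ x, HasDerivAt a (a₁ x) x
  deriv₂ : ∀ x, HasDerivAt a₁ (a₂ x) x
  bound₁ : ∀ x, |a₁ x| ≤ A
  bound₂ : ∀ x, |a₂ x| ≤ A
  holder₂ : ∀ x y, |a₂ x - a₂ y| ≤ A * |x - y| ^ α

/-- The mean value inequality between `x` and `y`. -/
theorem abs_sub_le_of_hasDerivAt_uIcc {f f' : ℝ → ℝ} {x y C : ℝ}
    (hf : ∀ z ∈ uIcc x y, HasDerivAt f (f' z) z) (hC : ∀ z ∈ uIcc x y, |f' z| ≤ C) :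
    |f y - f x| ≤ C * |y - x| := by
  have := (convex_uIcc x y).norm_image_sub_le_of_norm_hasDerivWithin_le
    (fun z hz => (hf z hz).hasDerivWithinAt) (fun z hz => hC z hz)
    left_mem_uIcc right_mem_uIcc
  simpa using this

theorem abs_sub_le_of_mem_uIcc {x y z : ℝ} (hz : z ∈ uIcc x y) : |z - x| ≤ |y - x| :=
  abs_sub_left_of_mem_uIcc hz

namespace HolderC2Bound

variable {α A : ℝ} {a a₁ a₂ : ℝ → ℝ}

theorem nonneg (h : HolderC2Bound α A a a₁ a₂) : 0 ≤ A := (abs_nonneg _).trans (h.bound₁ 0)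

theorem abs_sub_le (h : HolderC2Bound α A a a₁ a₂) (x y : ℝ) : |a y - a x| ≤ A * |y - x| :=
  abs_sub_le_of_hasDerivAt_uIcc (fun z _ => h.deriv₁ z) (fun z _ => h.bound₁ z)

theorem abs_deriv_sub_le (h : HolderC2Bound α A a a₁ a₂) (x y : ℝ) :
    |a₁ y - a₁ x| ≤ A * |y - x| :=
  abs_sub_le_of_hasDerivAt_uIcc (fun z _ => h.deriv₂ z) (fun z _ => h.bound₂ z)

theorem abs_taylor_one_le (h : HolderC2Bound α A a a₁ a₂) (x y : ℝ) :
    |a y - a x - a₁ x * (y - x)| ≤ A * |y - x| ^ 2 := by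
  have := abs_sub_le_of_hasDerivAt_uIcc (f := fun z => a z - a₁ x * z)
    (f' := fun z => a₁ z - a₁ x) (x := x) (y := y) (C := A * |y - x|)
    (fun z _ => by simpa using (h.deriv₁ z).fun_sub ((hasDerivAt_id' z).const_mul (a₁ x)))
    (fun z hz => (h.abs_deriv_sub_le x z).trans
      (mul_le_mul_of_nonneg_left (abs_sub_le_of_mem_uIcc hz) h.nonneg))
  convert this using 1
  · congr 1; ring
  · ring

theorem abs_taylor_two_le (h : HolderC2Bound α A a a₁ a₂) (hα : 0 ≤ α) (x y : ℝ) :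
    |a y - a x - a₁ x * (y - x) - a₂ x * ((y - x) ^ 2 / 2)| ≤
      A * (|y - x| ^ 2 * |y - x| ^ α) := by
  have hA := h.nonneg
  have h1 : ∀ z ∈ uIcc x y, |a₁ z - a₁ x - a₂ x * (z - x)| ≤ A * |y - x| ^ α * |y - x| := by
    intro z hz
    have := abs_sub_le_of_hasDerivAt_uIcc (f := fun z => a₁ z - a₂ x * z)
      (f' := fun z => a₂ z - a₂ x) (x := x) (y := z) (C := A * |y - x| ^ α)
      (fun z _ => by simpa using (h.deriv₂ z).fun_sub ((hasDerivAt_id' z).const_mul (a₂ x)))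
      (fun u hu => (h.holder₂ u x).trans (by
        have := (abs_sub_le_of_mem_uIcc hu).trans (abs_sub_le_of_mem_uIcc hz)
        gcongr))
    have h2 : |a₁ z - a₁ x - a₂ x * (z - x)| ≤ A * |y - x| ^ α * |z - x| := by
      convert this using 1
      congr 1; ring
    have := abs_sub_le_of_mem_uIcc hz
    exact h2.trans (by gcongr)
  have := abs_sub_le_of_hasDerivAt_uIcc (f := fun z => a z - a₁ x * z - a₂ x * ((z - x) ^ 2 / 2))
      (f' := fun z => a₁ z - a₁ x - a₂ x * (z - x)) (x := x) (y := y)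
      (C := A * |y - x| ^ α * |y - x|)
      (fun z _ => by
        have e := ((h.deriv₁ z).fun_sub ((hasDerivAt_id' z).const_mul (a₁ x))).fun_sub
          (((((hasDerivAt_id' z).sub_const x).fun_pow 2).div_const 2).const_mul (a₂ x))
        refine e.congr_deriv ?_
        ring) h1
  convert this using 1
  · congr 1; simp; ring
  · ring

end HolderC2Bound

/-! ### The commutator kernel and its derivative -/

/-- The kernel `(a y - a x) cot ((x - y) / 2)` of the commutator. -/
noncomputable def commKernel (a : ℝ → ℝ) (x y : ℝ) : ℝ := (a y - a x) * cotHalf (x - y)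

/-- Minus the derivative of `commKernel a x y` in `x`, where `a₁` is the derivative of `a`. -/
noncomputable def commKernelDeriv (a a₁ : ℝ → ℝ) (x y : ℝ) : ℝ :=
  (a y - a x + a₁ x * sin (x - y)) / (1 - cos (x - y))

namespace HolderC2Bound

variable {α A : ℝ} {a a₁ a₂ : ℝ → ℝ}

theorem hasDerivAt_commKernel (h : HolderC2Bound α A a a₁ a₂) {x y : ℝ} (hxy : x - y ≠ 0)
    (h4 : |x - y| ≤ 4) :
    HasDerivAt (fun x => commKernel a x y) (-commKernelDeriv a a₁ x y) x := by
  have hw := one_sub_cos_pos hxy h4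
  have hk : HasDerivAt (fun z => cotHalf (z - y)) (-1 / (1 - cos (x - y))) x :=
    (hasDerivAt_cotHalf hxy h4).comp_sub_const x y
  have := ((h.deriv₁ x).const_sub (a y)).fun_mul hk
  refine this.congr_deriv ?_
  rw [commKernelDeriv, cotHalf]
  field_simp
  ring

theorem abs_commKernel_le (h : HolderC2Bound α A a a₁ a₂) {x y : ℝ} (h4 : |x - y| ≤ 4) :
    |commKernel a x y| ≤ 50 * A := by
  have hA := h.nonneg
  rcases eq_or_ne (x - y) 0 with h0 | h0
  · simp [commKernel, cotHalf, h0, hA]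
  have hpos : 0 < |x - y| := abs_pos.2 h0
  rw [commKernel, abs_mul]
  calc |a y - a x| * |cotHalf (x - y)| ≤ (A * |x - y|) * (50 / |x - y|) := by
        gcongr
        · rw [abs_sub_comm x]; exact h.abs_sub_le x y
        · exact abs_cotHalf_le h4
    _ = 50 * A := by field_simp

theorem abs_commKernelDeriv_le (h : HolderC2Bound α A a a₁ a₂) {x y : ℝ} (h4 : |x - y| ≤ 4) :
    |commKernelDeriv a a₁ x y| ≤ 100 * A := by
  have hA := h.nonneg
  rcases eq_or_ne (x - y) 0 with h0 | h0
  · simp [commKernelDeriv, h0, hA]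
  have hw := one_sub_cos_pos h0 h4
  have hw2 := sq_div_le_one_sub_cos h4
  have h1 := h.abs_taylor_one_le x y
  have h2 := abs_sin_sub_self_le (x - y)
  have e : a y - a x + a₁ x * sin (x - y) =
    (a y - a x - a₁ x * (y - x)) + a₁ x * (sin (x - y) - (x - y)) := by ring
  rw [abs_sub_comm y x] at h1
  rw [commKernelDeriv, abs_div, abs_of_pos hw, div_le_iff₀ hw, e]
  have h3 : |a₁ x * (sin (x - y) - (x - y))| ≤ A * |x - y| ^ 2 := by
    rw [abs_mul]
    have h5 : |x - y| ^ 3 / 6 ≤ |x - y| ^ 2 := by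
      have := pow_nonneg (abs_nonneg (x - y)) 2
      nlinarith
    have := h.bound₁ x
    have := h2.trans h5
    gcongr
  refine (abs_add_le _ _).trans ((add_le_add h1 h3).trans ?_)
  rw [sq_abs]
  nlinarith

/-- The numerator of the `x`-derivative of `commKernelDeriv`. -/
theorem abs_second_deriv_num_le (h : HolderC2Bound α A a a₁ a₂) (hα : α ∈ Ioo (0 : ℝ) 1)
    {x y : ℝ} (h4 : |x - y| ≤ 4) :
    |a₂ x * (1 - cos (x - y)) - (a y - a x + a₁ x * sin (x - y))| ≤
      3 * A * (|x - y| ^ 2 * |x - y| ^ α) := by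
  have hA := h.nonneg
  set t := x - y with ht
  have hR := h.abs_taylor_two_le hα.1.le x y
  have hs := abs_sin_sub_self_le t
  have hc := abs_one_sub_cos_sub_le t
  have hyx : y - x = -t := by rw [ht]; ring
  rw [hyx, abs_neg] at hR
  -- If `1 - cos t`, `sin t` and `a y` are replaced by their Taylor polynomials, the left side
  -- cancels exactly; only the three remainders survive.
  have e : a₂ x * (1 - cos t) - (a y - a x + a₁ x * sin t) =
      a₂ x * (1 - cos t - t ^ 2 / 2) - a₁ x * (sin t - t)
        - (a y - a x - a₁ x * (-t) - a₂ x * ((-t) ^ 2 / 2)) := by ring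
  have h1 : |a₂ x * (1 - cos t - t ^ 2 / 2)| ≤ A * (t ^ 4 / 24) := by
    rw [abs_mul]
    have := h.bound₂ x
    gcongr
  have h2 : |a₁ x * (sin t - t)| ≤ A * (|t| ^ 3 / 6) := by
    rw [abs_mul]
    have := h.bound₁ x
    gcongr
  rw [e]
  refine (abs_sub _ _).trans ((add_le_add ((abs_sub _ _).trans (add_le_add h1 h2)) hR).trans ?_)
  have h5 : t ^ 4 / 24 + |t| ^ 3 / 6 ≤ |t| ^ 2 * (2 * |t| ^ α) := by
    have := abs_le_four_mul_rpow hα h4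
    have e4 : t ^ 4 = |t| ^ 4 := (Even.pow_abs ⟨2, rfl⟩ t).symm
    calc t ^ 4 / 24 + |t| ^ 3 / 6 = |t| ^ 2 * (|t| * (|t| / 24 + 1 / 6)) := by rw [e4]; ring
      _ ≤ |t| ^ 2 * (4 * |t| ^ α * (4 / 24 + 1 / 6)) := by gcongr
      _ ≤ |t| ^ 2 * (2 * |t| ^ α) := by
        have : 0 ≤ |t| ^ α := by positivity
        exact mul_le_mul_of_nonneg_left (by linarith) (by positivity)
  nlinarith

/-- With `n` the numerator and `w = 1 - cos t`, the quotient rule simplifies to `-a₁ x + sin t * (a₂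
x * w - n) / w ^ 2`. The bracket is of order `|t| ^ (2 + α)` and `w` is at least `t ^ 2 / 50`,
whence `7500 = 3 * 50 ^ 2`; the bounded term `a₁ x` contributes the remaining `4`. -/
theorem exists_hasDerivAt_commKernelDeriv (h : HolderC2Bound α A a a₁ a₂)
    (hα : α ∈ Ioo (0 : ℝ) 1) {x y : ℝ} (hxy : x - y ≠ 0) (h4 : |x - y| ≤ 4) :
    ∃ D, HasDerivAt (fun x => commKernelDeriv a a₁ x y) D x ∧
      |D| ≤ 7504 * A * (|x - y| ^ α / |x - y|) := by
  have hA := h.nonneg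
  have hw := one_sub_cos_pos hxy h4
  have hw2 := sq_div_le_one_sub_cos h4
  have hs := ((hasDerivAt_sin (x - y)).comp_sub_const x y)
  have hc := ((hasDerivAt_cos (x - y)).comp_sub_const x y).const_sub 1
  have hn := ((h.deriv₁ x).const_sub (a y)).fun_add ((h.deriv₂ x).fun_mul hs)
  have hd := hn.fun_div hc hw.ne'
  refine ⟨_, hd, ?_⟩
  have hN := h.abs_second_deriv_num_le hα h4
  have hlin := abs_le_four_mul_rpow hα h4
  set t := x - y with ht
  set n := a y - a x + a₁ x * sin t with hn_def
  set w := 1 - cos t with hw_def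
  have hpos : 0 < |t| := abs_pos.2 hxy
  have e : ((-a₁ x + (a₂ x * sin t + a₁ x * cos t)) * w - n * -(-sin t)) / w ^ 2 =
      -a₁ x + sin t * (a₂ x * w - n) / w ^ 2 := by
    have : cos t = 1 - w := by rw [hw_def]; ring
    rw [this]
    field_simp
    ring
  rw [e]
  have h1 : |sin t * (a₂ x * w - n) / w ^ 2| ≤ 7500 * A * (|t| ^ α / |t|) := by
    rw [abs_div, abs_mul, abs_of_pos (pow_pos hw 2), div_le_iff₀ (pow_pos hw 2)]
    rw [← sq_abs t] at hw2
    calc |sin t| * |a₂ x * w - n| ≤ |t| * (3 * A * (|t| ^ 2 * |t| ^ α)) := by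
          have := abs_sin_le_abs (x := t)
          gcongr
      _ = 7500 * A * (|t| ^ α / |t|) * (|t| ^ 2 / 50) ^ 2 := by field_simp; ring
      _ ≤ 7500 * A * (|t| ^ α / |t|) * w ^ 2 := by gcongr
  have h2 : |-a₁ x| ≤ 4 * A * (|t| ^ α / |t|) := by
    rw [abs_neg]
    refine (h.bound₁ x).trans ?_
    have : 1 ≤ 4 * (|t| ^ α / |t|) := by
      rw [← mul_div_assoc, le_div_iff₀ hpos]; linarith
    nlinarith
  refine (abs_add_le _ _).trans ((add_le_add h2 h1).trans (le_of_eq (by ring)))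

/-- As `x` tends to `y` the kernel tends to `-2 * a₁ y`, a value independent of `x`. Kernels at two
points near `y` can therefore be compared through it. -/
theorem abs_commKernel_add_le (h : HolderC2Bound α A a a₁ a₂) {x y : ℝ} (h0 : x - y ≠ 0)
    (h4 : |x - y| ≤ 4) :
    |commKernel a x y + 2 * a₁ y| ≤ 100 * A * |x - y| := by
  have hA := h.nonneg
  have hw := one_sub_cos_pos h0 h4
  have hw2 := sq_div_le_one_sub_cos h4
  have hT := h.abs_taylor_one_le y x
  have hs := abs_sin_sub_self_le (x - y)
  have hs' := abs_sin_le_abs (x := x - y)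
  have hc := abs_one_sub_cos_sub_le (x - y)
  rw [commKernel, cotHalf]
  set t := x - y with ht
  set w := 1 - cos t with hw_def
  have e : (a y - a x) * (sin t / w) + 2 * a₁ y =
      (a₁ y * (2 * (w - t ^ 2 / 2) - t * (sin t - t)) - (a x - a y - a₁ y * t) * sin t) / w := by
    field_simp
    ring
  have hpos : 0 < |t| := abs_pos.2 h0
  rw [← sq_abs t] at hw2
  have h1 : |2 * (w - t ^ 2 / 2) - t * (sin t - t)| ≤ |t| ^ 3 := by
    have e4 : t ^ 4 = |t| ^ 4 := (Even.pow_abs ⟨2, rfl⟩ t).symm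
    calc _ ≤ |2 * (w - t ^ 2 / 2)| + |t * (sin t - t)| := abs_sub _ _
      _ ≤ 2 * (|t| ^ 4 / 24) + |t| * (|t| ^ 3 / 6) := by
        rw [abs_mul, abs_mul, abs_two, ← e4]; gcongr
      _ = |t| ^ 3 * (|t| / 4) := by ring
      _ ≤ |t| ^ 3 * 1 := by gcongr; linarith
      _ = |t| ^ 3 := mul_one _
  have h2 := h.bound₁ y
  rw [e, abs_div, abs_of_pos hw, div_le_iff₀ hw]
  calc _ ≤ |a₁ y * (2 * (w - t ^ 2 / 2) - t * (sin t - t))| + |(a x - a y - a₁ y * t) * sin t| :=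
        abs_sub _ _
    _ ≤ A * |t| ^ 3 + A * |t| ^ 2 * |t| := by
        rw [abs_mul, abs_mul (a x - a y - a₁ y * t)]; gcongr
    _ = 100 * A * |t| * (|t| ^ 2 / 50) := by ring
    _ ≤ 100 * A * |t| * w := by gcongr

theorem abs_commKernelDeriv_sub_le_of_far (h : HolderC2Bound α A a a₁ a₂)
    (hα : α ∈ Ioo (0 : ℝ) 1) {x y z : ℝ} (hxy : x - y ≠ 0) (hπ : |x - y| ≤ π)
    (hz : |z - x| ≤ 1 / 2) (hfar : 2 * |z - x| ≤ |x - y|) :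
    |commKernelDeriv a a₁ z y - commKernelDeriv a a₁ x y| ≤
      30016 * A * |z - x| ^ α := by
  have hA := h.nonneg
  have hpos : 0 < |x - y| := abs_pos.2 hxy
  -- The whole segment from `x` to `z` keeps a distance from `y` comparable to `|x - y|`, so the
  -- derivative bound is uniform along it, at the price of a factor `4`.
  have hseg : ∀ ξ ∈ uIcc x z, |x - y| / 2 ≤ |ξ - y| ∧ |ξ - y| ≤ 4 ∧ |ξ - y| ≤ 2 * |x - y| := by
    intro ξ hξ
    have h1 := abs_sub_le_of_mem_uIcc hξ
    have h2 := abs_sub_abs_le_abs_sub (x - y) (ξ - y)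
    have h3 := abs_add_le (x - y) (ξ - x)
    rw [show x - y - (ξ - y) = -(ξ - x) by ring, abs_neg] at h2
    rw [show x - y + (ξ - x) = ξ - y by ring] at h3
    have := pi_lt_d2
    refine ⟨?_, ?_, ?_⟩ <;> linarith
  have hne : ∀ ξ ∈ uIcc x z, ξ - y ≠ 0 := fun ξ hξ =>
    abs_pos.1 (lt_of_lt_of_le (by positivity) (hseg ξ hξ).1)
  have key := fun ξ (hξ : ξ ∈ uIcc x z) =>
    h.exists_hasDerivAt_commKernelDeriv hα (hne ξ hξ) (hseg ξ hξ).2.1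
  have hmv := abs_sub_le_of_hasDerivAt_uIcc (f := fun ξ => commKernelDeriv a a₁ ξ y)
    (f' := deriv fun ξ => commKernelDeriv a a₁ ξ y) (x := x) (y := z)
    (C := 7504 * A * (4 * (|x - y| ^ α / |x - y|)))
    (fun ξ hξ => (key ξ hξ).choose_spec.1.differentiableAt.hasDerivAt)
    (fun ξ hξ => by
      obtain ⟨D, hD, hb⟩ := key ξ hξ
      rw [hD.deriv]
      refine hb.trans ?_
      obtain ⟨h1, -, h3⟩ := hseg ξ hξ
      have h5 : |ξ - y| ^ α ≤ 2 * |x - y| ^ α := by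
        calc |ξ - y| ^ α ≤ (2 * |x - y|) ^ α := by have := hα.1; gcongr
          _ = 2 ^ α * |x - y| ^ α := mul_rpow (by norm_num) (abs_nonneg _)
          _ ≤ 2 ^ (1 : ℝ) * |x - y| ^ α := by
            gcongr
            · norm_num
            · exact hα.2.le
          _ = 2 * |x - y| ^ α := by rw [rpow_one]
      gcongr
      calc |ξ - y| ^ α / |ξ - y| ≤ 2 * |x - y| ^ α / (|x - y| / 2) := by gcongr
        _ = 4 * (|x - y| ^ α / |x - y|) := by field_simp; norm_num)
  refine hmv.trans ?_
  -- As `|z - x| / |x - y| ≤ 1`, raising it to the power `α` only increases it.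
  have h6 : |x - y| ^ α / |x - y| * |z - x| ≤ |z - x| ^ α := by
    rcases eq_or_ne (z - x) 0 with hz0 | hz0
    · simp [hz0, hα.1.ne']
    have hzp : 0 < |z - x| := abs_pos.2 hz0
    have hle : |z - x| ≤ |x - y| := by linarith
    have h7 : |z - x| / |x - y| ≤ (|z - x| / |x - y|) ^ α :=
      self_le_rpow_of_le_one (by positivity) (by rw [div_le_one hpos]; exact hle) hα.2.le
    rw [div_rpow hzp.le hpos.le] at h7
    calc |x - y| ^ α / |x - y| * |z - x| = |x - y| ^ α * (|z - x| / |x - y|) := by ring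
      _ ≤ |x - y| ^ α * (|z - x| ^ α / |x - y| ^ α) := by gcongr
      _ = |z - x| ^ α := by
        have : |x - y| ^ α ≠ 0 := (rpow_pos_of_pos hpos _).ne'
        field_simp
  nlinarith

/-- Mean value inequality for the kernel minus its linear part at `x`: the derivative of this
difference is an increment of `commKernelDeriv`, already bounded. -/
theorem abs_commKernel_sub_add_le_of_far (h : HolderC2Bound α A a a₁ a₂)
    (hα : α ∈ Ioo (0 : ℝ) 1) {x y z : ℝ} (hxy : x - y ≠ 0) (hπ : |x - y| ≤ π)
    (hz : |z - x| ≤ 1 / 2) (hfar : 2 * |z - x| ≤ |x - y|) :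
    |commKernel a z y - commKernel a x y + (z - x) * commKernelDeriv a a₁ x y| ≤
      30016 * A * |z - x| ^ α * |z - x| := by
  have hA := h.nonneg
  have hpos : 0 < |x - y| := abs_pos.2 hxy
  have hmv := abs_sub_le_of_hasDerivAt_uIcc
    (f := fun ξ => commKernel a ξ y + ξ * commKernelDeriv a a₁ x y)
    (f' := fun ξ => -commKernelDeriv a a₁ ξ y + commKernelDeriv a a₁ x y) (x := x) (y := z)
    (C := 30016 * A * |z - x| ^ α)
    (fun ξ hξ => by
      have h1 := abs_sub_le_of_mem_uIcc hξ
      have h2 := abs_sub_abs_le_abs_sub (x - y) (ξ - y)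
      have h3 := abs_add_le (x - y) (ξ - x)
      rw [show x - y - (ξ - y) = -(ξ - x) by ring, abs_neg] at h2
      rw [show x - y + (ξ - x) = ξ - y by ring] at h3
      have := pi_lt_d2
      have hne : ξ - y ≠ 0 := abs_pos.1 (by linarith)
      have := (h.hasDerivAt_commKernel hne (by linarith)).fun_add
        ((hasDerivAt_id' ξ).mul_const (commKernelDeriv a a₁ x y))
      simpa using this)
    (fun ξ hξ => by
      have h1 := abs_sub_le_of_mem_uIcc hξ
      have := h.abs_commKernelDeriv_sub_le_of_far hα hxy hπ (h1.trans hz) (by linarith)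
      rw [neg_add_eq_sub, abs_sub_comm]
      refine this.trans ?_
      have := hα.1
      gcongr)
  convert hmv using 2
  ring

theorem abs_commKernelDeriv_sub_le (h : HolderC2Bound α A a a₁ a₂)
    (hα : α ∈ Ioo (0 : ℝ) 1) {x y z : ℝ} (hxy : x - y ≠ 0) (hπ : |x - y| ≤ π)
    (hz : |z - x| ≤ 1 / 2) :
    |commKernelDeriv a a₁ z y - commKernelDeriv a a₁ x y| ≤
      120064 * A * |z - x| ^ α * |x - y| ^ (-α) := by
  have hA := h.nonneg
  have hpos : 0 < |x - y| := abs_pos.2 hxy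
  have hpi := pi_lt_d2
  rcases le_total (2 * |z - x|) |x - y| with hfar | hnear
  · refine (h.abs_commKernelDeriv_sub_le_of_far hα hxy hπ hz hfar).trans ?_
    have := one_le_four_mul_rpow_neg hα hpos (by linarith)
    have h0 : 0 ≤ A * |z - x| ^ α := by positivity
    nlinarith
  · have h3 := abs_add_le (x - y) (z - x)
    rw [show x - y + (z - x) = z - y by ring] at h3
    have h1 := h.abs_commKernelDeriv_le (x := x) (y := y) (by linarith)
    have h2 := h.abs_commKernelDeriv_le (x := z) (y := y) (by linarith)
    refine (abs_sub _ _).trans ((add_le_add h2 h1).trans ?_)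
    have := one_le_two_mul_div_rpow hα hpos hnear
    have h5 : 0 ≤ |z - x| ^ α * |x - y| ^ (-α) := by positivity
    nlinarith [mul_nonneg hA h5]

/-- Near the diagonal both kernels are replaced by their common limit `-2 * a₁ y`. This needs `y` to
differ from `x` and `z`, since division by zero makes the kernel `0` on the diagonal. -/
theorem abs_commKernel_sub_add_le (h : HolderC2Bound α A a a₁ a₂)
    (hα : α ∈ Ioo (0 : ℝ) 1) {x y z : ℝ} (hxy : x - y ≠ 0) (hzy : z - y ≠ 0) (hπ : |x - y| ≤ π)
    (hz : |z - x| ≤ 1 / 2) :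
    |commKernel a z y - commKernel a x y + (z - x) * commKernelDeriv a a₁ x y| ≤
      120064 * A * |z - x| ^ α * |z - x| * |x - y| ^ (-α) := by
  have hA := h.nonneg
  have hpos : 0 < |x - y| := abs_pos.2 hxy
  have hpi := pi_lt_d2
  rcases le_total (2 * |z - x|) |x - y| with hfar | hnear
  · refine (h.abs_commKernel_sub_add_le_of_far hα hxy hπ hz hfar).trans ?_
    have := one_le_four_mul_rpow_neg hα hpos (by linarith)
    have h0 : 0 ≤ A * |z - x| ^ α * |z - x| := by positivity
    nlinarith
  · have h3 := abs_add_le (x - y) (z - x)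
    rw [show x - y + (z - x) = z - y by ring] at h3
    have h1 := h.abs_commKernel_add_le hxy (by linarith)
    have h2 := h.abs_commKernel_add_le hzy (by linarith)
    have h4 := h.abs_commKernelDeriv_le (x := x) (y := y) (by linarith)
    have h6 : |(z - x) * commKernelDeriv a a₁ x y| ≤ |z - x| * (100 * A) := by
      rw [abs_mul]; gcongr
    have e : commKernel a z y - commKernel a x y + (z - x) * commKernelDeriv a a₁ x y =
      (commKernel a z y + 2 * a₁ y) - (commKernel a x y + 2 * a₁ y) +
        (z - x) * commKernelDeriv a a₁ x y := by ring
    have h7 : |commKernel a z y - commKernel a x y + (z - x) * commKernelDeriv a a₁ x y| ≤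
        600 * A * |z - x| := by
      rw [e]
      refine (abs_add_le _ _).trans
        ((add_le_add ((abs_sub _ _).trans (add_le_add h2 h1)) h6).trans ?_)
      nlinarith
    refine h7.trans ?_
    have := one_le_two_mul_div_rpow hα hpos hnear
    have h5 : 0 ≤ |z - x| ^ α * |x - y| ^ (-α) := by positivity
    calc 600 * A * |z - x| ≤ 600 * A * |z - x| * (2 * (|z - x| ^ α * |x - y| ^ (-α))) :=
          le_mul_of_one_le_right (by positivity) this
      _ ≤ 120064 * A * |z - x| * (|z - x| ^ α * |x - y| ^ (-α)) := by
        have : 0 ≤ A * |z - x| * (|z - x| ^ α * |x - y| ^ (-α)) := by positivity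
        nlinarith
      _ = _ := by ring

end HolderC2Bound

/-! ### Integrals over a period -/

theorem intervalIntegrable_abs_rpow {β : ℝ} (hβ : -1 < β) (u v : ℝ) :
    IntervalIntegrable (fun t : ℝ => |t| ^ β) volume u v := by
  have hpos : ∀ w : ℝ, 0 ≤ w → IntervalIntegrable (fun t : ℝ => |t| ^ β) volume 0 w := by
    intro w hw
    refine (intervalIntegral.intervalIntegrable_rpow' (a := 0) (b := w) hβ).congr ?_
    intro t ht
    rw [uIoc_of_le hw] at ht
    simp only [abs_of_pos ht.1]
  have hall : ∀ w : ℝ, IntervalIntegrable (fun t : ℝ => |t| ^ β) volume 0 w := by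
    intro w
    rcases le_total 0 w with hw | hw
    · exact hpos w hw
    · have := (hpos (-w) (by linarith)).comp_sub_left 0
      simpa using this
  exact (hall u).symm.trans (hall v)

theorem intervalIntegrable_abs_sub_rpow {β : ℝ} (hβ : -1 < β) (x : ℝ) :
    IntervalIntegrable (fun y : ℝ => |x - y| ^ β) volume (x - π) (x + π) := by
  have := (intervalIntegrable_abs_rpow hβ π (-π)).comp_sub_left x
  simpa using this

theorem integral_abs_sub_rpow (β x : ℝ) :
    ∫ y in (x - π)..(x + π), |x - y| ^ β = ∫ t in (-π)..π, |t| ^ β := by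
  rw [intervalIntegral.integral_comp_sub_left (fun t : ℝ => |t| ^ β) x]
  simp

theorem abs_sub_le_pi_of_mem_Ioc {x y : ℝ} (hy : y ∈ Ioc (x - π) (x + π)) : |x - y| ≤ π := by
  rw [abs_le]; constructor <;> linarith [hy.1, hy.2]

theorem abs_sub_le_four {x y z : ℝ} (hz : |z - x| ≤ 1 / 2) (hy : y ∈ Ioc (x - π) (x + π)) :
    |z - y| ≤ 4 := by
  have h1 := abs_sub_le_pi_of_mem_Ioc hy
  have h2 := abs_sub_le z x y
  linarith [pi_lt_d2]

theorem abs_intervalIntegral_le_of_ae {f g : ℝ → ℝ} {u v : ℝ} (huv : u ≤ v)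
    (hfg : ∀ᵐ y, y ∈ Ioc u v → |f y| ≤ g y) (hg : IntervalIntegrable g volume u v) :
    |∫ y in u..v, f y| ≤ ∫ y in u..v, g y :=
  intervalIntegral.norm_integral_le_of_norm_le (f := f) huv hfg hg

theorem intervalIntegrable_of_abs_le {f g : ℝ → ℝ} {u v : ℝ} (huv : u ≤ v) (hf : Measurable f)
    (hg : IntervalIntegrable g volume u v) (hfg : ∀ y ∈ Ioc u v, |f y| ≤ g y) :
    IntervalIntegrable f volume u v := by
  refine hg.mono_fun' hf.aestronglyMeasurable ?_
  rw [uIoc_of_le huv]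
  exact (ae_restrict_iff' measurableSet_Ioc).2 (ae_of_all _ hfg)

theorem sub_pi_le_add_pi (x : ℝ) : x - π ≤ x + π := by linarith [pi_pos]

theorem intervalIntegral_period_eq {f : ℝ → ℝ} (hf : Function.Periodic f (2 * π)) (c x : ℝ) :
    ∫ y in (c - π)..(c + π), f y = ∫ y in (x - π)..(x + π), f y := by
  have := hf.intervalIntegral_add_eq (c - π) (x - π)
  rwa [show c - π + 2 * π = c + π by ring, show x - π + 2 * π = x + π by ring] at this

/-! ### Existence of the principal value -/

theorem intervalIntegrable_sub_mul_cotHalf {f : ℝ → ℝ} {α K x : ℝ} (hα : α ∈ Ioo (0 : ℝ) 1)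
    (hf : Continuous f) (hK : ∀ y, |x - y| ≤ π → |f y - f x| ≤ K * |x - y| ^ α) :
    IntervalIntegrable (fun y => (f y - f x) * cotHalf (x - y)) volume (x - π) (x + π) := by
  refine intervalIntegrable_of_abs_le (g := fun y => (K * 50) * |x - y| ^ (α - 1))
    (sub_pi_le_add_pi x) (by fun_prop)
    ((intervalIntegrable_abs_sub_rpow (by linarith [hα.1]) x).const_mul _) ?_
  intro y hy
  have hπ := abs_sub_le_pi_of_mem_Ioc hy
  have hpi := pi_lt_d2
  rcases eq_or_ne (x - y) 0 with h0 | h0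
  · have : x = y := sub_eq_zero.1 h0
    subst this
    -- On the diagonal both sides vanish, by the convention `0 ^ (α - 1) = 0`.
    simp [zero_rpow (show α - 1 ≠ 0 by linarith [hα.2])]
  have hpos : 0 < |x - y| := abs_pos.2 h0
  calc |(f y - f x) * cotHalf (x - y)| ≤ (K * |x - y| ^ α) * (50 / |x - y|) := by
        rw [abs_mul]
        exact mul_le_mul (hK y hπ) (abs_cotHalf_le (by linarith)) (abs_nonneg _)
          ((abs_nonneg _).trans (hK y hπ))
    _ = K * 50 * |x - y| ^ (α - 1) := by rw [rpow_sub_one hpos.ne']; ring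

theorem measurableSet_truncation (x ε : ℝ) :
    MeasurableSet {y : ℝ | ε < |x - y| ∧ |x - y| ≤ π} := by
  measurability

theorem truncation_subset (x ε : ℝ) :
    {y : ℝ | ε < |x - y| ∧ |x - y| ≤ π} ⊆ Icc (x - π) (x + π) := by
  rintro y ⟨-, hy⟩
  rw [abs_le] at hy
  constructor <;> linarith [hy.1, hy.2]

/-- The truncated kernel is odd about `x`. Reflection invariance of the integral needs no
integrability, so `ε` is arbitrary. -/
theorem setIntegral_cotHalf_truncation (x ε : ℝ) :
    ∫ y in {y : ℝ | ε < |x - y| ∧ |x - y| ≤ π}, cotHalf (x - y) = 0 := by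
  set φ : ℝ → ℝ := fun t => ({t : ℝ | ε < |t| ∧ |t| ≤ π}).indicator cotHalf t with hφ
  have h1 : ∫ y in {y : ℝ | ε < |x - y| ∧ |x - y| ≤ π}, cotHalf (x - y) = ∫ y, φ (x - y) := by
    rw [← integral_indicator (measurableSet_truncation x ε)]
    rfl
  have hodd : ∀ t, φ (-t) = -φ t := by
    intro t
    by_cases ht : ε < |t| ∧ |t| ≤ π
    · simp [hφ, indicator, ht, cotHalf_neg]
    · simp [hφ, indicator, ht]
  have h2 := integral_neg_eq_self φ volume
  simp only [hodd, integral_neg] at h2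
  rw [h1, integral_sub_left_eq_self φ volume x]
  linarith

theorem integrableOn_cotHalf_truncation (x : ℝ) {ε : ℝ} (hε : 0 < ε) :
    IntegrableOn (fun y => cotHalf (x - y)) {y : ℝ | ε < |x - y| ∧ |x - y| ≤ π} := by
  have hpi := pi_lt_d2
  refine Measure.integrableOn_of_bounded (M := 50 / ε)
    ((measure_mono (truncation_subset x ε)).trans_lt measure_Icc_lt_top).ne
    (measurable_cotHalf.comp (measurable_const.sub measurable_id)).aestronglyMeasurable ?_
  refine (ae_restrict_iff' (measurableSet_truncation x ε)).2 (ae_of_all _ ?_)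
  rintro y ⟨h1, h2⟩
  refine (abs_cotHalf_le (by linarith)).trans ?_
  gcongr

/-- Subtracting `f x` leaves every truncated integral unchanged and makes the integrand absolutely
integrable; dominated convergence then removes the truncation. -/
theorem hasHilbertAt_of_holder {f : ℝ → ℝ} {α K x : ℝ} (hα : α ∈ Ioo (0 : ℝ) 1)
    (hf : Continuous f) (hK : ∀ y, |x - y| ≤ π → |f y - f x| ≤ K * |x - y| ^ α) :
    HasHilbertAt f x
      (1 / (2 * π) * ∫ y in (x - π)..(x + π), (f y - f x) * cotHalf (x - y)) := by
  have hint := intervalIntegrable_sub_mul_cotHalf hα hf hK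
  rw [intervalIntegrable_iff_integrableOn_Icc_of_le (sub_pi_le_add_pi x)] at hint
  have htrunc : ∀ ε : ℝ, 0 < ε → truncHilbert f x ε =
      1 / (2 * π) * ∫ y in {y : ℝ | ε < |x - y| ∧ |x - y| ≤ π},
        (f y - f x) * cotHalf (x - y) := by
    intro ε hε
    have h1 := hint.mono_set (truncation_subset x ε)
    have h2 := (integrableOn_cotHalf_truncation x hε).const_mul (f x)
    have h3 := integral_add h1 h2
    rw [integral_const_mul, setIntegral_cotHalf_truncation, mul_zero, add_zero] at h3
    rw [truncHilbert, ← h3]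
    congr 2
    ext y
    rw [div_tan_half]
    ring
  rw [HasHilbertAt, intervalIntegral.integral_of_le (sub_pi_le_add_pi x),
    ← integral_Icc_eq_integral_Ioc, ← integral_indicator measurableSet_Icc]
  have hlim : Tendsto (fun ε : ℝ => ∫ y, ({y : ℝ | ε < |x - y| ∧ |x - y| ≤ π}).indicator
      (fun y => (f y - f x) * cotHalf (x - y)) y) (𝓝[>] 0)
      (𝓝 (∫ y, (Icc (x - π) (x + π)).indicator
        (fun y => (f y - f x) * cotHalf (x - y)) y)) := by
    refine tendsto_integral_filter_of_dominated_convergence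
      (fun y => ‖(Icc (x - π) (x + π)).indicator
        (fun y => (f y - f x) * cotHalf (x - y)) y‖) ?_ ?_ ?_ ?_
    · refine Eventually.of_forall fun ε => Measurable.aestronglyMeasurable ?_
      exact Measurable.indicator (by fun_prop) (measurableSet_truncation x ε)
    · refine Eventually.of_forall fun ε => ae_of_all _ fun y => ?_
      exact norm_indicator_le_of_subset (truncation_subset x ε) _ y
    · exact ((integrable_indicator_iff measurableSet_Icc).2 hint).norm
    · refine ae_of_all _ fun y => tendsto_const_nhds.congr' ?_
      rcases eq_or_ne (x - y) 0 with h0 | h0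
      · refine Eventually.of_forall fun ε => ?_
        have : x = y := sub_eq_zero.1 h0
        subst this
        simp [indicator]
      · have hpos : 0 < |x - y| := abs_pos.2 h0
        filter_upwards [Ioo_mem_nhdsGT hpos] with ε hε
        have hiff : y ∈ Icc (x - π) (x + π) ↔ y ∈ {y : ℝ | ε < |x - y| ∧ |x - y| ≤ π} := by
          refine ⟨fun hy => ⟨hε.2, ?_⟩, fun hy => truncation_subset x ε hy⟩
          rw [abs_le]; constructor <;> linarith [hy.1, hy.2]
        simp only [indicator, hiff]
  refine (hlim.const_mul (1 / (2 * π))).congr' ?_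
  filter_upwards [self_mem_nhdsWithin] with ε hε
  rw [htrunc ε hε, integral_indicator (measurableSet_truncation x ε)]

/-! ### The commutator as an absolutely convergent integral -/

/-- `2π` times the commutator `[ℋ, a] g`. -/
noncomputable def commIntegral (a g : ℝ → ℝ) (x : ℝ) : ℝ :=
  ∫ y in (x - π)..(x + π), commKernel a x y * g y

/-- Minus the derivative of `commIntegral a g`, where `a₁` is the derivative of `a`. -/
noncomputable def commIntegralDeriv (a a₁ g : ℝ → ℝ) (x : ℝ) : ℝ :=
  ∫ y in (x - π)..(x + π), commKernelDeriv a a₁ x y * g y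

theorem commKernel_periodic_right {a : ℝ → ℝ} (ha : Function.Periodic a (2 * π)) (x : ℝ) :
    Function.Periodic (commKernel a x) (2 * π) := fun y => by
  rw [commKernel, commKernel, ha y, ← sub_sub, cotHalf_periodic.sub_eq]

theorem commKernel_periodic_left {a : ℝ → ℝ} (ha : Function.Periodic a (2 * π)) (x y : ℝ) :
    commKernel a (x + 2 * π) y = commKernel a x y := by
  rw [commKernel, commKernel, ha x, add_sub_right_comm, cotHalf_periodic]

theorem commKernelDeriv_periodic_right {a : ℝ → ℝ} (ha : Function.Periodic a (2 * π))
    (a₁ : ℝ → ℝ) (x : ℝ) : Function.Periodic (commKernelDeriv a a₁ x) (2 * π) := fun y => by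
  rw [commKernelDeriv, commKernelDeriv, ha y, ← sub_sub, sin_sub_two_pi, cos_sub_two_pi]

section

variable {α A B : ℝ} {a a₁ a₂ g : ℝ → ℝ}

/-- By periodicity the window may be centred anywhere, so values at two nearby points are compared
over one fixed window. -/
theorem commIntegral_eq (ha : Function.Periodic a (2 * π)) (hg : Function.Periodic g (2 * π))
    (c x : ℝ) : commIntegral a g x = ∫ y in (c - π)..(c + π), commKernel a x y * g y :=
  intervalIntegral_period_eq ((commKernel_periodic_right ha x).mul hg) x c

theorem commIntegralDeriv_eq (ha : Function.Periodic a (2 * π))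
    (hg : Function.Periodic g (2 * π)) (c x : ℝ) :
    commIntegralDeriv a a₁ g x = ∫ y in (c - π)..(c + π), commKernelDeriv a a₁ x y * g y :=
  intervalIntegral_period_eq ((commKernelDeriv_periodic_right ha a₁ x).mul hg) x c

theorem commIntegral_periodic (ha : Function.Periodic a (2 * π))
    (hg : Function.Periodic g (2 * π)) :
    Function.Periodic (commIntegral a g) (2 * π) := fun x => by
  rw [commIntegral_eq ha hg x, commIntegral]
  simp only [commKernel_periodic_left ha]

namespace HolderC2Bound

theorem continuous (h : HolderC2Bound α A a a₁ a₂) : Continuous a :=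
  continuous_iff_continuousAt.2 fun x => (h.deriv₁ x).continuousAt

theorem measurable_commKernel_mul (h : HolderC2Bound α A a a₁ a₂) (hg : Continuous g) (x : ℝ) :
    Measurable fun y => commKernel a x y * g y := by
  have := h.continuous
  unfold commKernel
  fun_prop

theorem measurable_commKernelDeriv_mul (h : HolderC2Bound α A a a₁ a₂) (hg : Continuous g)
    (x : ℝ) : Measurable fun y => commKernelDeriv a a₁ x y * g y := by
  have := h.continuous
  unfold commKernelDeriv
  fun_prop

theorem abs_commKernel_mul_le (h : HolderC2Bound α A a a₁ a₂) (hB : ∀ y, |g y| ≤ B) {x y : ℝ}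
    (h4 : |x - y| ≤ 4) : |commKernel a x y * g y| ≤ 50 * A * B := by
  have hA := h.nonneg
  rw [abs_mul]
  exact mul_le_mul (h.abs_commKernel_le h4) (hB y) (abs_nonneg _) (by positivity)

theorem abs_commKernelDeriv_mul_le (h : HolderC2Bound α A a a₁ a₂) (hB : ∀ y, |g y| ≤ B)
    {x y : ℝ} (h4 : |x - y| ≤ 4) : |commKernelDeriv a a₁ x y * g y| ≤ 100 * A * B := by
  have hA := h.nonneg
  rw [abs_mul]
  exact mul_le_mul (h.abs_commKernelDeriv_le h4) (hB y) (abs_nonneg _) (by positivity)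

theorem intervalIntegrable_commKernel_mul (h : HolderC2Bound α A a a₁ a₂) (hg : Continuous g)
    (hB : ∀ y, |g y| ≤ B) {x z : ℝ} (hz : |z - x| ≤ 1 / 2) :
    IntervalIntegrable (fun y => commKernel a z y * g y) volume (x - π) (x + π) :=
  intervalIntegrable_of_abs_le (sub_pi_le_add_pi x) (h.measurable_commKernel_mul hg z)
    (g := fun _ => 50 * A * B) intervalIntegrable_const
    fun _ hy => h.abs_commKernel_mul_le hB (abs_sub_le_four hz hy)

theorem intervalIntegrable_commKernelDeriv_mul (h : HolderC2Bound α A a a₁ a₂)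
    (hg : Continuous g) (hB : ∀ y, |g y| ≤ B) {x z : ℝ} (hz : |z - x| ≤ 1 / 2) :
    IntervalIntegrable (fun y => commKernelDeriv a a₁ z y * g y) volume (x - π) (x + π) :=
  intervalIntegrable_of_abs_le (sub_pi_le_add_pi x) (h.measurable_commKernelDeriv_mul hg z)
    (g := fun _ => 100 * A * B) intervalIntegrable_const
    fun _ hy => h.abs_commKernelDeriv_mul_le hB (abs_sub_le_four hz hy)

theorem abs_commIntegral_le (h : HolderC2Bound α A a a₁ a₂) (hB : ∀ y, |g y| ≤ B) (x : ℝ) :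
    |commIntegral a g x| ≤ 50 * A * B * (2 * π) := by
  have := intervalIntegral.norm_integral_le_of_norm_le_const (a := x - π) (b := x + π)
    (f := fun y => commKernel a x y * g y) (C := 50 * A * B) (fun y hy => by
      rw [uIoc_of_le (sub_pi_le_add_pi x)] at hy
      exact h.abs_commKernel_mul_le hB (abs_sub_le_four (by simp) hy))
  rwa [show x + π - (x - π) = 2 * π by ring, abs_of_pos two_pi_pos] at this

theorem abs_commIntegralDeriv_le (h : HolderC2Bound α A a a₁ a₂) (hB : ∀ y, |g y| ≤ B) (x : ℝ) :
    |commIntegralDeriv a a₁ g x| ≤ 100 * A * B * (2 * π) := by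
  have := intervalIntegral.norm_integral_le_of_norm_le_const (a := x - π) (b := x + π)
    (f := fun y => commKernelDeriv a a₁ x y * g y) (C := 100 * A * B) (fun y hy => by
      rw [uIoc_of_le (sub_pi_le_add_pi x)] at hy
      exact h.abs_commKernelDeriv_mul_le hB (abs_sub_le_four (by simp) hy))
  rwa [show x + π - (x - π) = 2 * π by ring, abs_of_pos two_pi_pos] at this

theorem abs_commIntegralDeriv_sub_le (h : HolderC2Bound α A a a₁ a₂) (hα : α ∈ Ioo (0 : ℝ) 1)
    (ha : Function.Periodic a (2 * π)) (hgp : Function.Periodic g (2 * π)) (hg : Continuous g)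
    (hB : ∀ y, |g y| ≤ B) {x z : ℝ} (hz : |z - x| ≤ 1 / 2) :
    |commIntegralDeriv a a₁ g z - commIntegralDeriv a a₁ g x| ≤
      120064 * A * B * (∫ t in (-π)..π, |t| ^ (-α)) * |z - x| ^ α := by
  have hA := h.nonneg
  have hB0 : 0 ≤ B := (abs_nonneg _).trans (hB 0)
  rw [commIntegralDeriv_eq ha hgp x z, commIntegralDeriv,
    ← intervalIntegral.integral_sub (h.intervalIntegrable_commKernelDeriv_mul hg hB hz)
      (h.intervalIntegrable_commKernelDeriv_mul hg hB (by simp))]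
  refine (abs_intervalIntegral_le_of_ae (sub_pi_le_add_pi x)
    (g := fun y => 120064 * A * B * |z - x| ^ α * |x - y| ^ (-α)) ?_
    ((intervalIntegrable_abs_sub_rpow (by linarith [hα.2]) x).const_mul _)).trans_eq ?_
  · filter_upwards [compl_mem_ae_iff.2 (measure_singleton x)] with y hyx hy
    have hxy : x - y ≠ 0 := fun e => hyx (sub_eq_zero.1 e).symm
    have := h.abs_commKernelDeriv_sub_le hα hxy (abs_sub_le_pi_of_mem_Ioc hy) hz
    rw [← sub_mul, abs_mul]
    calc _ ≤ 120064 * A * |z - x| ^ α * |x - y| ^ (-α) * B :=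
          mul_le_mul this (hB y) (abs_nonneg _) (by positivity)
      _ = _ := by ring
  · rw [intervalIntegral.integral_const_mul, integral_abs_sub_rpow]
    ring

theorem abs_commIntegral_sub_add_le (h : HolderC2Bound α A a a₁ a₂) (hα : α ∈ Ioo (0 : ℝ) 1)
    (ha : Function.Periodic a (2 * π)) (hgp : Function.Periodic g (2 * π)) (hg : Continuous g)
    (hB : ∀ y, |g y| ≤ B) {x z : ℝ} (hz : |z - x| ≤ 1 / 2) :
    |commIntegral a g z - commIntegral a g x + (z - x) * commIntegralDeriv a a₁ g x| ≤
      120064 * A * B * (∫ t in (-π)..π, |t| ^ (-α)) * |z - x| ^ α * |z - x| := by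
  have hA := h.nonneg
  have hB0 : 0 ≤ B := (abs_nonneg _).trans (hB 0)
  have h0 : |x - x| ≤ 1 / 2 := by simp
  rw [commIntegral_eq ha hgp x z, commIntegral, commIntegralDeriv,
    ← intervalIntegral.integral_sub (h.intervalIntegrable_commKernel_mul hg hB hz)
      (h.intervalIntegrable_commKernel_mul hg hB h0),
    ← intervalIntegral.integral_const_mul,
    ← intervalIntegral.integral_add
      ((h.intervalIntegrable_commKernel_mul hg hB hz).sub
        (h.intervalIntegrable_commKernel_mul hg hB h0))
      ((h.intervalIntegrable_commKernelDeriv_mul hg hB h0).const_mul _)]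
  refine (abs_intervalIntegral_le_of_ae (sub_pi_le_add_pi x)
    (g := fun y => 120064 * A * B * |z - x| ^ α * |z - x| * |x - y| ^ (-α)) ?_
    ((intervalIntegrable_abs_sub_rpow (by linarith [hα.2]) x).const_mul _)).trans_eq ?_
  -- The two diagonal points `y = x` and `y = z`, where the kernel estimate is not available, form a
  -- null set.
  · filter_upwards [compl_mem_ae_iff.2 (measure_singleton x),
      compl_mem_ae_iff.2 (measure_singleton z)] with y hyx hyz hy
    have hxy : x - y ≠ 0 := fun e => hyx (sub_eq_zero.1 e).symm
    have hzy : z - y ≠ 0 := fun e => hyz (sub_eq_zero.1 e).symm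
    have := h.abs_commKernel_sub_add_le hα hxy hzy (abs_sub_le_pi_of_mem_Ioc hy) hz
    rw [← sub_mul, ← mul_assoc, ← add_mul, abs_mul]
    calc _ ≤ 120064 * A * |z - x| ^ α * |z - x| * |x - y| ^ (-α) * B :=
          mul_le_mul this (hB y) (abs_nonneg _) (by positivity)
      _ = _ := by ring
  · rw [intervalIntegral.integral_const_mul, integral_abs_sub_rpow]
    ring

/-- The integrated expansion has remainder of order `|z - x| ^ (1 + α)`, which is `o(|z - x|)`. -/
theorem hasDerivAt_commIntegral (h : HolderC2Bound α A a a₁ a₂) (hα : α ∈ Ioo (0 : ℝ) 1)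
    (ha : Function.Periodic a (2 * π)) (hgp : Function.Periodic g (2 * π)) (hg : Continuous g)
    (hB : ∀ y, |g y| ≤ B) (x : ℝ) :
    HasDerivAt (commIntegral a g) (-commIntegralDeriv a a₁ g x) x := by
  set M := 120064 * A * B * (∫ t in (-π)..π, |t| ^ (-α)) with hM
  rw [hasDerivAt_iff_tendsto]
  have hlim : Tendsto (fun z => M * |z - x| ^ α) (𝓝 x) (𝓝 0) := by
    have : Continuous fun z => M * |z - x| ^ α :=
      continuous_const.mul
        ((continuous_abs.comp (continuous_sub_right x)).rpow_const fun _ => Or.inr hα.1.le)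
    have := this.tendsto x
    simpa [hα.1.ne'] using this
  refine squeeze_zero' (Eventually.of_forall fun z => by positivity) ?_ hlim
  filter_upwards [Metric.closedBall_mem_nhds x (show (0 : ℝ) < 1 / 2 by norm_num)] with z hz
  have hz' : |z - x| ≤ 1 / 2 := hz
  have key := h.abs_commIntegral_sub_add_le hα ha hgp hg hB hz'
  rw [← hM] at key
  rcases eq_or_ne z x with rfl | hne
  · simp [hα.1.ne']
  have hpos : 0 < |z - x| := abs_pos.2 (sub_ne_zero.2 hne)
  rw [smul_eq_mul, mul_neg, sub_neg_eq_add, norm_eq_abs, norm_eq_abs, inv_mul_le_iff₀ hpos]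
  linarith

theorem abs_commIntegralDeriv_sub_le_rpow (h : HolderC2Bound α A a a₁ a₂)
    (hα : α ∈ Ioo (0 : ℝ) 1) (ha : Function.Periodic a (2 * π))
    (hgp : Function.Periodic g (2 * π)) (hg : Continuous g) (hB : ∀ y, |g y| ≤ B) (x z : ℝ) :
    |commIntegralDeriv a a₁ g z - commIntegralDeriv a a₁ g x| ≤
      (120064 * (∫ t in (-π)..π, |t| ^ (-α)) + 800 * π) * (A * B) * |z - x| ^ α := by
  have hA := h.nonneg
  have hB0 : 0 ≤ B := (abs_nonneg _).trans (hB 0)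
  have hJ : 0 ≤ ∫ t in (-π)..π, |t| ^ (-α) :=
    intervalIntegral.integral_nonneg (by linarith [pi_pos]) fun t _ => by positivity
  have hr : 0 ≤ |z - x| ^ α := by positivity
  have hpi := pi_pos
  rcases le_total |z - x| (1 / 2) with hz | hz
  · refine (h.abs_commIntegralDeriv_sub_le hα ha hgp hg hB hz).trans ?_
    have : 0 ≤ 800 * π * (A * B) * |z - x| ^ α := by positivity
    linarith
  -- At distance at least `1 / 2` the supremum bound is enough: two values of size `200 * π * A *
  -- B`, and a factor `2` from `1 ≤ 2 * |z - x| ^ α`, give `800 * π`.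
  · refine (abs_sub _ _).trans ((add_le_add (h.abs_commIntegralDeriv_le hB z)
      (h.abs_commIntegralDeriv_le hB x)).trans ?_)
    have h1 : 1 ≤ 2 * |z - x| ^ α := by
      have := one_le_two_mul_div_rpow (t := 1) hα one_pos (show 1 ≤ 2 * |z - x| by linarith)
      simpa using this
    have h2 : 0 ≤ 120064 * (∫ t in (-π)..π, |t| ^ (-α)) * (A * B) * |z - x| ^ α := by positivity
    have h3 : 0 ≤ 400 * π * (A * B) := by positivity
    have h4 := mul_le_mul_of_nonneg_left h1 h3
    linarith

/-- Product rule for increments: `1` comes from the increment of `g`, and `4` from the Lipschitz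
bound on `a` read as a Hölder bound. -/
theorem abs_mul_sub_mul_le (h : HolderC2Bound α A a a₁ a₂) (hα : α ∈ Ioo (0 : ℝ) 1)
    (hA : ∀ y, |a y| ≤ A) (hB : ∀ y, |g y| ≤ B) {x y : ℝ} (h4 : |x - y| ≤ 4)
    (hgh : |g y - g x| ≤ B * |x - y| ^ α) :
    |(a * g) y - (a * g) x| ≤ 5 * (A * B) * |x - y| ^ α := by
  have hA0 := h.nonneg
  have hB0 : 0 ≤ B := (abs_nonneg _).trans (hB 0)
  have h1 := h.abs_sub_le x y
  rw [abs_sub_comm y x] at h1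
  have h2 := abs_le_four_mul_rpow hα h4
  have e : (a * g) y - (a * g) x = a y * (g y - g x) + (a y - a x) * g x := by
    simp only [Pi.mul_apply]; ring
  rw [e]
  calc _ ≤ |a y * (g y - g x)| + |(a y - a x) * g x| := abs_add_le _ _
    _ ≤ A * (B * |x - y| ^ α) + A * (4 * |x - y| ^ α) * B := by
      rw [abs_mul, abs_mul]
      have := hA y
      have := hB x
      have := h1.trans (mul_le_mul_of_nonneg_left h2 hA0)
      gcongr
    _ = _ := by ring

/-- Both principal values are absolutely convergent integrals, and `(a y * g y - a x * g x) - a x *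
(g y - g x) = (a y - a x) * g y`. -/
theorem commutator_hilbert_eq (h : HolderC2Bound α A a a₁ a₂) (hα : α ∈ Ioo (0 : ℝ) 1)
    (hA : ∀ y, |a y| ≤ A) (hg : Continuous g) (hB : ∀ y, |g y| ≤ B)
    (hgh : ∀ x y, |g y - g x| ≤ B * |x - y| ^ α) :
    commutator hilbert a g = fun x => 1 / (2 * π) * commIntegral a g x := by
  ext x
  have hpi := pi_lt_d2
  have h1 : ∀ y, |x - y| ≤ π → |g y - g x| ≤ B * |x - y| ^ α := fun y _ => hgh x y
  have h2 : ∀ y, |x - y| ≤ π → |(a * g) y - (a * g) x| ≤ 5 * (A * B) * |x - y| ^ α :=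
    fun y hy => h.abs_mul_sub_mul_le hα hA hB (by linarith) (hgh x y)
  have hag : Continuous (a * g) := h.continuous.mul hg
  have e1 : hilbert g x = _ := (hasHilbertAt_of_holder hα hg h1).limUnder_eq
  have e2 : hilbert (a * g) x = _ := (hasHilbertAt_of_holder hα hag h2).limUnder_eq
  have i1 := (intervalIntegrable_sub_mul_cotHalf hα hg h1).const_mul (a x)
  have i2 := intervalIntegrable_sub_mul_cotHalf hα hag h2
  rw [commutator, Pi.sub_apply, Pi.mul_apply, e1, e2, mul_left_comm, ← mul_sub,
    ← intervalIntegral.integral_const_mul, ← intervalIntegral.integral_sub i2 i1, commIntegral]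
  congr 2
  ext y
  simp only [Pi.mul_apply, commKernel]
  ring

end HolderC2Bound
end

/-! ### Norms -/

theorem abs_le_of_supNorm_le {f : ℝ → ℝ} {N : ℝ≥0∞} (hN : N ≠ ∞) (hf : supNorm f ≤ N) (x : ℝ) :
    |f x| ≤ N.toReal := by
  have h1 : ‖f x‖ₑ ≤ N := (le_iSup (fun x => ‖f x‖ₑ) x).trans hf
  have := ENNReal.toReal_mono hN h1
  simpa using this

theorem abs_sub_le_of_holderSeminorm_le {α : ℝ} {f : ℝ → ℝ} {N : ℝ≥0∞} (hN : N ≠ ∞)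
    (hf : holderSeminorm α f ≤ N) (x y : ℝ) : |f x - f y| ≤ N.toReal * |x - y| ^ α := by
  rcases eq_or_ne x y with rfl | hne
  · simp only [sub_self, abs_zero]; positivity
  have h1 : ENNReal.ofReal (|f x - f y| / |x - y| ^ α) ≤ N :=
    by
    refine le_trans ?_ hf
    unfold holderSeminorm
    exact le_iSup_of_le x (le_iSup_of_le y
      (le_iSup (fun _ : x ≠ y => ENNReal.ofReal (|f x - f y| / |x - y| ^ α)) hne))
  have h2 := (ENNReal.ofReal_le_iff_le_toReal hN).1 h1
  have hpos : 0 < |x - y| := abs_pos.2 (sub_ne_zero.2 hne)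
  rwa [div_le_iff₀ (rpow_pos_of_pos hpos _)] at h2

theorem supNorm_le_ofReal {f : ℝ → ℝ} {c : ℝ} (hf : ∀ x, |f x| ≤ c) :
    supNorm f ≤ ENNReal.ofReal c :=
  iSup_le fun x => by
    rw [← ofReal_norm]
    exact ENNReal.ofReal_le_ofReal (hf x)

theorem holderSeminorm_le_ofReal {α c : ℝ} {f : ℝ → ℝ}
    (hf : ∀ x y, |f x - f y| ≤ c * |x - y| ^ α) : holderSeminorm α f ≤ ENNReal.ofReal c :=
  iSup_le fun x => iSup_le fun y => iSup_le fun hne => by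
    have hpos : 0 < |x - y| := abs_pos.2 (sub_ne_zero.2 hne)
    refine ENNReal.ofReal_le_ofReal ?_
    rw [div_le_iff₀ (rpow_pos_of_pos hpos _)]
    exact hf x y

theorem periodic_deriv {f : ℝ → ℝ} {T : ℝ} (hf : Function.Periodic f T) :
    Function.Periodic (deriv f) T := fun x => by
  rw [← deriv_comp_add_const, hf.funext]

theorem MemCkα.holderC2Bound {α : ℝ} {a : ℝ → ℝ} (ha : MemCkα 2 α a) :
    HolderC2Bound α (holderNorm 2 α a).toReal a (deriv a) (deriv (deriv a)) ∧
      ∀ x, |a x| ≤ (holderNorm 2 α a).toReal := by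
  have hN := ha.norm_lt_top.ne
  have hc := ha.contDiff
  have hd : Differentiable ℝ a := hc.differentiable (by norm_num)
  have hd' : Differentiable ℝ (deriv a) := by
    have := (contDiff_succ_iff_deriv (n := 1)).1 (by simpa [one_add_one_eq_two] using hc)
    exact this.2.2.differentiable (by norm_num)
  have e : holderNorm 2 α a = (supNorm a + supNorm (deriv a)) +
      (supNorm (deriv (deriv a)) + holderSeminorm α (deriv (deriv a))) := by
    simp [holderNorm, Finset.sum_range_succ, iteratedDeriv_succ]
  have h0 : supNorm a ≤ holderNorm 2 α a := by
    rw [e]; exact le_self_add.trans le_self_add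
  have h1 : supNorm (deriv a) ≤ holderNorm 2 α a := by
    rw [e]; exact le_add_self.trans le_self_add
  have h2 : supNorm (deriv (deriv a)) ≤ holderNorm 2 α a := by
    rw [e]; exact le_self_add.trans le_add_self
  have h3 : holderSeminorm α (deriv (deriv a)) ≤ holderNorm 2 α a := by
    rw [e]; exact le_add_self.trans le_add_self
  exact ⟨⟨fun x => (hd x).hasDerivAt, fun x => (hd' x).hasDerivAt, abs_le_of_supNorm_le hN h1,
    abs_le_of_supNorm_le hN h2, abs_sub_le_of_holderSeminorm_le hN h3⟩,
    abs_le_of_supNorm_le hN h0⟩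

theorem holderNorm_one (α : ℝ) (f : ℝ → ℝ) :
    holderNorm 1 α f = supNorm f + (supNorm (deriv f) + holderSeminorm α (deriv f)) := by
  simp [holderNorm]

theorem MemCkα.deriv_bounds {α : ℝ} {b : ℝ → ℝ} (hb : MemCkα 1 α b) :
    (∀ x, |deriv b x| ≤ (holderNorm 1 α b).toReal) ∧
      ∀ x y, |deriv b y - deriv b x| ≤ (holderNorm 1 α b).toReal * |x - y| ^ α := by
  have hN := hb.norm_lt_top.ne
  have h1 : supNorm (deriv b) ≤ holderNorm 1 α b := by
    rw [holderNorm_one]; exact le_self_add.trans le_add_self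
  have h2 : holderSeminorm α (deriv b) ≤ holderNorm 1 α b := by
    rw [holderNorm_one]; exact le_add_self.trans le_add_self
  refine ⟨abs_le_of_supNorm_le hN h1, fun x y => ?_⟩
  rw [abs_sub_comm]
  exact abs_sub_le_of_holderSeminorm_le hN h2 x y

end PeriodicHolder

/-! ### The commutator estimate -/

theorem lemma2p1 (α : ℝ) (hα : α ∈ Set.Ioo (0 : ℝ) 1) :
    ∃ C : ℝ≥0, 0 < C ∧ ∀ a b : ℝ → ℝ,
      PeriodicHolder.MemCkα 2 α a → PeriodicHolder.MemCkα 1 α b →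
        (∀ x : ℝ, ∃ L : ℝ, PeriodicHolder.HasHilbertAt (a * deriv b) x L) ∧
        (∀ x : ℝ, ∃ L : ℝ, PeriodicHolder.HasHilbertAt (deriv b) x L) ∧
        PeriodicHolder.MemCkα 1 α
          (PeriodicHolder.commutator PeriodicHolder.hilbert a (deriv b)) ∧
        PeriodicHolder.holderNorm 1 α
            (PeriodicHolder.commutator PeriodicHolder.hilbert a (deriv b)) ≤
          C * PeriodicHolder.holderNorm 2 α a * PeriodicHolder.holderNorm 1 α b := by
  open PeriodicHolder in
  have hpi := pi_pos
  set J := ∫ t in (-π)..π, |t| ^ (-α) with hJ_def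
  have hJ : 0 ≤ J :=
    intervalIntegral.integral_nonneg (by linarith) fun t _ => by positivity
  set c := 1 / (2 * π) with hc_def
  have hc : 0 < c := by positivity
  have hc1 : c * (2 * π) = 1 := by rw [hc_def]; field_simp
  set H := c * (120064 * J + 800 * π) with hH_def
  have hH : 0 ≤ H := by positivity
  -- The suprema of the commutator and of its derivative contribute `50` and `100`, the Hölder
  -- seminorm of the derivative contributes `H`.
  refine ⟨(150 + H).toNNReal, Real.toNNReal_pos.2 (by positivity), ?_⟩
  intro a b ha hb
  obtain ⟨h, hA⟩ := ha.holderC2Bound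
  obtain ⟨hB, hgh⟩ := hb.deriv_bounds
  have hg : Continuous (deriv b) := hb.contDiff.continuous_deriv (by simp)
  have hgp : Function.Periodic (deriv b) (2 * π) := periodic_deriv hb.periodic
  have hA0 := h.nonneg
  have hB0 : 0 ≤ (holderNorm 1 α b).toReal := ENNReal.toReal_nonneg
  have hcomm : commutator hilbert a (deriv b) = fun x => c * commIntegral a (deriv b) x :=
    h.commutator_hilbert_eq hα hA hg hB hgh
  set A := (holderNorm 2 α a).toReal with hA_def
  set B := (holderNorm 1 α b).toReal with hB_def
  set F := commutator hilbert a (deriv b) with hF_def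
  have hder : ∀ x, HasDerivAt F (c * -commIntegralDeriv a (deriv a) (deriv b) x) x := fun x => by
    rw [hcomm]
    exact (h.hasDerivAt_commIntegral hα ha.periodic hgp hg hB x).const_mul c
  have hderiv : deriv F = fun x => c * -commIntegralDeriv a (deriv a) (deriv b) x :=
    funext fun x => (hder x).deriv
  have hF0 : ∀ x, |F x| ≤ 50 * (A * B) := fun x => by
    rw [hcomm]
    simp only [abs_mul, abs_of_pos hc]
    calc _ ≤ c * (50 * A * B * (2 * π)) := by gcongr; exact h.abs_commIntegral_le hB x
      _ = c * (2 * π) * (50 * (A * B)) := by ring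
      _ = _ := by rw [hc1, one_mul]
  have hF1 : ∀ x, |deriv F x| ≤ 100 * (A * B) := fun x => by
    rw [hderiv]
    simp only [abs_mul, abs_of_pos hc, abs_neg]
    calc _ ≤ c * (100 * A * B * (2 * π)) := by gcongr; exact h.abs_commIntegralDeriv_le hB x
      _ = c * (2 * π) * (100 * (A * B)) := by ring
      _ = _ := by rw [hc1, one_mul]
  have hFα : ∀ x y, |deriv F x - deriv F y| ≤ H * (A * B) * |x - y| ^ α := fun x y => by
    rw [hderiv]
    simp only
    rw [← mul_sub, neg_sub_neg, abs_mul, abs_of_pos hc, abs_sub_comm]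
    calc _ ≤ c * ((120064 * J + 800 * π) * (A * B) * |x - y| ^ α) := by
          gcongr; exact h.abs_commIntegralDeriv_sub_le_rpow hα ha.periodic hgp hg hB y x
      _ = _ := by rw [hH_def]; ring
  have hcont : Continuous (deriv F) := by
    refine continuous_iff_continuousAt.2 fun x => ?_
    rw [ContinuousAt, tendsto_iff_norm_sub_tendsto_zero]
    refine squeeze_zero (fun _ => norm_nonneg _) (fun z => hFα z x) ?_
    have : Continuous fun z => H * (A * B) * |z - x| ^ α :=
      continuous_const.mul
        ((continuous_abs.comp (continuous_sub_right x)).rpow_const fun _ => Or.inr hα.1.le)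
    have := this.tendsto x
    simpa [hα.1.ne'] using this
  have hnorm : holderNorm 1 α F ≤ ENNReal.ofReal ((150 + H) * (A * B)) := by
    rw [holderNorm_one]
    refine (add_le_add (supNorm_le_ofReal hF0)
      (add_le_add (supNorm_le_ofReal hF1) (holderSeminorm_le_ofReal hFα))).trans_eq ?_
    rw [← ENNReal.ofReal_add (by positivity) (by positivity),
      ← ENNReal.ofReal_add (by positivity) (by positivity)]
    congr 1
    ring
  have hpi2 := pi_lt_d2
  refine ⟨fun x => ⟨_, hasHilbertAt_of_holder hα (h.continuous.mul hg) fun y hy =>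
      h.abs_mul_sub_mul_le hα hA hB (by linarith) (hgh x y)⟩,
    fun x => ⟨_, hasHilbertAt_of_holder hα hg fun y _ => hgh x y⟩,
    ⟨?_, contDiff_one_iff_deriv.2 ⟨fun x => (hder x).differentiableAt, hcont⟩,
      hnorm.trans_lt ENNReal.ofReal_lt_top⟩, hnorm.trans_eq ?_⟩
  · rw [hcomm]
    intro x
    simp only [commIntegral_periodic ha.periodic hgp x]
  · rw [ENNReal.ofReal_mul (by positivity), ENNReal.ofReal_mul hA0, hA_def, hB_def,
      ENNReal.ofReal_toReal ha.norm_lt_top.ne, ENNReal.ofReal_toReal hb.norm_lt_top.ne, mul_assoc]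
    -- `ENNReal.ofReal` is by definition the coercion of `Real.toNNReal`.
    rfl
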